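/- Let $G$ be a finite simple graph with at least one edge, bipartite with respect to a partition $V=A\sqcup B$ of its vertex set, and put $a=|A|$. Let $\mathbb K$ be a field, $S=\mathbb K[x_v : v\in V]$, $\mathfrak m=(x_v : v\in V)\subseteq S$. For $k\ge 0$, a $k$-cover of $G$ is a vector $c\in\mathbb N^{V}$ with $c_i+c_j\ge k$ for every edge $\{i,j\}$ of $G$. Let $A(G)=\bigoplus_{k\ge 0}A(G)_k\subseteq S[t]$ be the graded $S$-algebra whose component $A(G)_k$ is the $\mathbb K$-span of the monomials $x^c t^k$ with $c$ a $k$-cover, and let $\bar A(G)=A(G)/\mathfrak m A(G)$, graded by the images $\bar A(G)_k$ of the $A(G)_k$. Let $\dim \bar A(G)$ be its Krull dimension, and let $e(\bar A(G))$ be its multiplicity, that is, $d!$ times the leading coefficient of the Hilbert polynomial of $\bar A(G)$ (the polynomial which agrees with $k\mapsto\dim_{\mathbb K}\bar A(G)_k$ for all large $k$), where $d$ is the degree of that polynomial. Suppose that $s\ge 0$ is an integer such that every vertex in $B$ has degree at least $s$ in $G$ (so $s\le a$). Then $$\dim \bar A(G)\le a-s+2,$$ and if equality holds, then $e(\bar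 A(G))$ is defined and $$e(\bar A(G))\le\binom{a}{s}\,(a-s)!.$$ -/

import Mathlib

open Filter
open scoped Polynomial

namespace CoverAlgebra

variable {V : Type*}

/-- The vector `a` is a `k`-cover of `G`: `a i + a j ≥ k` for every edge `{i, j}`.
For `k ≥ 1` and a graph with an edge such a vector is automatically nonzero; for `k = 0` the zero
vector is admitted, so that the component of degree `0` of the vertex cover algebra is the whole
polynomial ring. -/
def IsCover (G : SimpleGraph V) (k : ℕ) (a : V →₀ ℕ) : Prop :=
  ∀ i j : V, G.Adj i j → k ≤ a i + a j

theorem IsCover.add {G : SimpleGraph V} {k l : ℕ} {a b : V →₀ ℕ}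
    (ha : IsCover G k a) (hb : IsCover G l b) : IsCover G (k + l) (a + b) := by
  intro i j hij
  have h1 := ha i j hij
  have h2 := hb i j hij
  simp only [Finsupp.add_apply]
  omega

theorem isCover_zero (G : SimpleGraph V) (a : V →₀ ℕ) : IsCover G 0 a :=
  fun _ _ _ => Nat.zero_le _

/-- The vertex cover algebra `A(G) ⊆ S[t]`, where `S = K[x_v : v ∈ V]`: the `S`-subalgebra of those
polynomials all of whose monomials `x ^ a * t ^ k` have `a` a `k`-cover of `G`. In other words
`A(G) = ⨁ₖ A(G)ₖ` with `A(G)ₖ` the `K`-span of the `x ^ a * t ^ k`, `a` a `k`-cover. -/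
noncomputable def vertexCoverAlgebra (K : Type*) [Field K] (G : SimpleGraph V) :
    Subalgebra (MvPolynomial V K) (MvPolynomial V K)[X] where
  carrier := {f | ∀ (k : ℕ) (a : V →₀ ℕ), a ∈ (f.coeff k).support → IsCover G k a}
  mul_mem' := by
    classical
    intro f g hf hg k a ha
    rw [Polynomial.coeff_mul] at ha
    obtain ⟨p, hp, hpa⟩ := Finset.mem_biUnion.mp (MvPolynomial.support_sum ha)
    obtain ⟨b, hb, c, hc, rfl⟩ := Finset.mem_add.mp (MvPolynomial.support_mul _ _ hpa)
    rw [← Finset.HasAntidiagonal.mem_antidiagonal.mp hp]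
    exact (hf _ _ hb).add (hg _ _ hc)
  add_mem' := by
    classical
    intro f g hf hg k a ha
    rw [Polynomial.coeff_add] at ha
    rcases Finset.mem_union.mp (MvPolynomial.support_add ha) with h | h
    · exact hf k a h
    · exact hg k a h
  algebraMap_mem' := by
    intro r k a ha
    rcases Nat.eq_zero_or_pos k with rfl | hk
    · exact isCover_zero G a
    · rw [Polynomial.algebraMap_apply, Algebra.algebraMap_self_apply, Polynomial.coeff_C_of_ne_zero hk.ne'] at ha
      simp at ha

noncomputable instance instCommRingVertexCoverAlgebra (K : Type*) [Field K] (G : SimpleGraph V) :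
    CommRing (vertexCoverAlgebra K G) := inferInstance

/-- The homogeneous maximal ideal `𝔪 = (x_v : v ∈ V)` of `K[x_v : v ∈ V]`. -/
noncomputable def irrelevantIdeal (V K : Type*) [Field K] : Ideal (MvPolynomial V K) :=
  Ideal.span (Set.range MvPolynomial.X)

/-- The algebra of basic covers `Ā(G) = A(G) / 𝔪 A(G)`. -/
abbrev BasicCoverAlgebra (K : Type*) [Field K] (G : SimpleGraph V) : Type _ :=
  vertexCoverAlgebra K G ⧸
    (irrelevantIdeal V K).map (algebraMap (MvPolynomial V K) (vertexCoverAlgebra K G))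

/-- The homogeneous component `A(G)ₖ`: the elements of `A(G)` of the form `p * t ^ k`. -/
noncomputable def coverPiece (K : Type*) [Field K] (G : SimpleGraph V) (k : ℕ) :
    Submodule K (vertexCoverAlgebra K G) where
  carrier := {f | ∀ j : ℕ, j ≠ k → (f : (MvPolynomial V K)[X]).coeff j = 0}
  zero_mem' := by intro j _; simp
  add_mem' := by intro f g hf hg j hj; simp [hf j hj, hg j hj]
  smul_mem' := by intro c f hf j hj; simp [hf j hj]

/-- The homogeneous component `Ā(G)ₖ`: the image of `A(G)ₖ` in `Ā(G)`. -/
noncomputable def basicCoverPiece (K : Type*) [Field K] (G : SimpleGraph V) (k : ℕ) :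
    Submodule K (BasicCoverAlgebra K G) :=
  (coverPiece K G k).map (Ideal.Quotient.mkₐ K
    ((irrelevantIdeal V K).map
      (algebraMap (MvPolynomial V K) (vertexCoverAlgebra K G)))).toLinearMap

/-- The Hilbert function `k ↦ dim_K Ā(G)ₖ`. -/
noncomputable def hilbertFunction (K : Type*) [Field K] (G : SimpleGraph V) (k : ℕ) : ℕ :=
  Module.finrank K (basicCoverPiece K G k)

/-- `P` is the Hilbert polynomial of the Hilbert function `H`: both agree at all large integers
(so `P` is unique when it exists). -/
def IsHilbertPolynomial (H : ℕ → ℕ) (P : ℚ[X]) : Prop :=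
  ∀ᶠ k : ℕ in atTop, (H k : ℚ) = P.eval (k : ℚ)

/-- `e` is the multiplicity attached to the Hilbert function `H`: there is a Hilbert polynomial,
and `e` is its leading coefficient times the factorial of its degree. -/
def IsMultiplicity (H : ℕ → ℕ) (e : ℚ) : Prop :=
  ∃ P : ℚ[X], IsHilbertPolynomial H P ∧ e = P.leadingCoeff * (P.natDegree.factorial : ℚ)

end CoverAlgebra

/-! Call a `k`-cover basic if none of its positive entries can be lowered. The basic `k`-covers
index a `K`-basis of `Ā(G)ₖ`: every other cover monomial is divisible by a variable inside `A(G)`,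
and no basic cover occurs in an element of `𝔪 A(G)` (`span_toBasic_coverMonomial`,
`linearIndependent_toBasic_coverMonomial`).

For bipartite `G` a basic cover is determined by its restriction to `A`, and the restrictions that
occur are the weights whose positive superlevel sets are closed, that is, unions of neighbourhoods
of vertices of `B` (`basicCoverEquiv`). The Hilbert function thus counts multichains of closed sets:
`H (k + 1) = ∑ j, β j * k.choose j`, where `β j` is the number of chains of `j + 1` closed sets
(`card_closedWeights`).

A nonempty closed set contains a neighbourhood of a vertex of `B`, hence has at least `s` elements.
A chain of closed sets therefore has at most `a - s + 2` members, so `H` grows with order at most `a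
- s + 1`. As `Ā(G)` is finitely generated, Noether normalization turns this into the dimension bound
(`ringKrullDim_le_of_filtration_growth`). In case of equality `β (a - s + 1)` cannot vanish, so it
is the multiplicity. The chains it counts start at `∅`, jump to an `s`-set and then gain one element
at a time up to `A`; there are at most `a! / s!` of them. -/

namespace CoverAlgebra

/-! ### Chains and multichains in a family of finite sets -/

section Chains

variable {V : Type*} [DecidableEq V]

/-- The number of chains with `j + 1` members and largest member `x`, all members below `x`
being taken from the family `P`. -/
def chainCount (P : Finset (Finset V)) : ℕ → Finset V → ℕ
  | 0, _ => 1
  | j + 1, x => ∑ y ∈ P with y ⊂ x, chainCount P j y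

/-- Cardinalities strictly increase along a chain, and they skip everything strictly between `0` and
`s`. -/
theorem chainCount_eq_zero {P : Finset (Finset V)} {s : ℕ}
    (hP : ∀ x ∈ P, x.Nonempty → s ≤ x.card) (j : ℕ) (x : Finset V) (hx : x ∈ P)
    (hj : x.card + 1 < j + 1 + s) : chainCount P (j + 1) x = 0 := by
  induction j generalizing x with
  | zero =>
    rw [chainCount, Finset.sum_eq_zero]
    intro y hy
    obtain ⟨-, hyx⟩ := Finset.mem_filter.mp hy
    have h1 := Finset.card_lt_card hyx
    have := hP x hx (Finset.card_pos.mp (by omega))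
    omega
  | succ j ih =>
    rw [chainCount, Finset.sum_eq_zero]
    intro y hy
    obtain ⟨hyP, hyx⟩ := Finset.mem_filter.mp hy
    have h1 := Finset.card_lt_card hyx
    exact ih y hyP (by omega)

/-- These chains are as long as possible, so the member just below the top has exactly one element
less (any smaller one contributes `0`), until an `s`-set is reached, below which only `∅` can lie.
The top `x` need not belong to `P`, which allows the sum to be enlarged to all subsets of a given
size. -/
theorem chainCount_mul_factorial_le {P : Finset (Finset V)} {s : ℕ}
    (hP : ∀ x ∈ P, x.Nonempty → s ≤ x.card) (j : ℕ) (x : Finset V) (hx : x.card = s + j) :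
    chainCount P (j + 1) x * s.factorial ≤ x.card.factorial := by
  induction j generalizing x with
  | zero =>
    have : chainCount P (0 + 1) x ≤ 1 := by
      rw [chainCount]
      simp only [chainCount, Finset.sum_const, smul_eq_mul, mul_one]
      refine Finset.card_le_one.mpr fun y hy z hz => ?_
      have key : ∀ w ∈ ({w ∈ P | w ⊂ x} : Finset (Finset V)), w = ∅ := by
        intro w hw
        obtain ⟨hwP, hwx⟩ := Finset.mem_filter.mp hw
        have h1 := Finset.card_lt_card hwx
        by_contra hne
        have := hP w hwP (Finset.nonempty_iff_ne_empty.mpr hne)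
        omega
      rw [key y hy, key z hz]
    rw [hx]
    exact (Nat.mul_le_mul_right _ this).trans (by simp)
  | succ j ih =>
    have h1 : chainCount P (j + 1 + 1) x ≤
        ∑ y ∈ x.powersetCard (s + j), chainCount P (j + 1) y := by
      rw [chainCount]
      refine Finset.sum_le_sum_of_ne_zero fun y hy hne => ?_
      obtain ⟨hyP, hyx⟩ := Finset.mem_filter.mp hy
      refine Finset.mem_powersetCard.mpr ⟨hyx.subset, ?_⟩
      have h2 := Finset.card_lt_card hyx
      by_contra h3
      exact hne (chainCount_eq_zero hP j y hyP (by omega))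
    calc chainCount P (j + 1 + 1) x * s.factorial
        ≤ ∑ y ∈ x.powersetCard (s + j), chainCount P (j + 1) y * s.factorial := by
          rw [← Finset.sum_mul]; exact Nat.mul_le_mul_right _ h1
      _ ≤ ∑ y ∈ x.powersetCard (s + j), (s + j).factorial := by
          refine Finset.sum_le_sum fun y hy => ?_
          obtain ⟨-, hyc⟩ := Finset.mem_powersetCard.mp hy
          simpa [hyc] using ih y hyc
      _ = x.card.factorial := by
          rw [Finset.sum_const, Finset.card_powersetCard, hx, ← add_assoc, smul_eq_mul,
            Nat.choose_succ_self_right, Nat.factorial_succ]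

/-- The chains of maximal possible size: they all end in the largest set `A`. -/
theorem sum_chainCount_le {P : Finset (Finset V)} {A : Finset V} {s : ℕ}
    (hsA : s ≤ A.card) (hPA : ∀ x ∈ P, x ⊆ A) (hP : ∀ x ∈ P, x.Nonempty → s ≤ x.card) :
    ∑ x ∈ P, chainCount P (A.card - s + 1) x ≤ A.card.choose s * (A.card - s).factorial := by
  have h1 : ∑ x ∈ P, chainCount P (A.card - s + 1) x ≤
      ∑ x ∈ {A}, chainCount P (A.card - s + 1) x := by
    refine Finset.sum_le_sum_of_ne_zero fun x hx hne => ?_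
    rw [Finset.mem_singleton]
    refine Finset.eq_of_subset_of_card_le (hPA x hx) ?_
    by_contra h3
    exact hne (chainCount_eq_zero hP _ x hx (by omega))
  rw [Finset.sum_singleton] at h1
  refine h1.trans ?_
  have h2 := chainCount_mul_factorial_le hP (A.card - s) A (by omega)
  rw [← Nat.choose_mul_factorial_mul_factorial hsA, mul_right_comm] at h2
  exact Nat.le_of_mul_le_mul_right h2 s.factorial_pos

/-- A multichain counting function is a combination of binomial coefficients. -/
theorem multichain_eq_sum_chainCount {P : Finset (Finset V)} (f : ℕ → Finset V → ℕ)
    (h1 : ∀ x ∈ P, f 0 x = 1) (h2 : ∀ k, ∀ x ∈ P, f (k + 1) x = ∑ y ∈ P with y ⊆ x, f k y)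
    (N : ℕ) (hN : ∀ x ∈ P, chainCount P (N + 1) x = 0) (k : ℕ) (x : Finset V) (hx : x ∈ P) :
    f k x = ∑ j ∈ Finset.range (N + 1), chainCount P j x * k.choose j := by
  induction k generalizing x with
  | zero => simp [h1 x hx, Finset.sum_range_succ', chainCount]
  | succ k ih =>
    have hsplit : ({y ∈ P | y ⊆ x} : Finset (Finset V)) = insert x {y ∈ P | y ⊂ x} := by
      ext y
      simp only [Finset.mem_filter, Finset.mem_insert]
      constructor
      · rintro ⟨hy, hyx⟩
        rcases hyx.eq_or_ssubset with h | h
        · exact Or.inl h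
        · exact Or.inr ⟨hy, h⟩
      · rintro (rfl | ⟨hy, hyx⟩)
        · exact ⟨hx, subset_rfl⟩
        · exact ⟨hy, hyx.subset⟩
    -- The term `y = x` gives the coefficients `k.choose j` and the terms `y ⊂ x` give the same ones
    -- with `j` shifted; Pascal's rule adds them. `hN` removes the term that the shift pushes out of
    -- the range.
    rw [h2 k x hx, hsplit, Finset.sum_insert (by simp), ih x hx,
      Finset.sum_congr rfl fun y hy => ih y (Finset.mem_filter.mp hy).1, Finset.sum_comm]
    simp_rw [← Finset.sum_mul]
    have h3 : ∀ j, ∑ y ∈ P with y ⊂ x, chainCount P j y = chainCount P (j + 1) x := fun j => rfl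
    simp_rw [h3]
    rw [Finset.sum_range_succ (fun j => chainCount P (j + 1) x * k.choose j), hN x hx, zero_mul,
      add_zero, Finset.sum_range_succ', Finset.sum_range_succ' (fun j => _ * (k + 1).choose j)]
    simp only [Nat.choose_succ_succ, mul_add, Finset.sum_add_distrib, Nat.choose_zero_right]
    ring

end Chains

/-! ### Closed weights as multichains of closed sets -/

section Closed

variable {V : Type*} (G : SimpleGraph V)

/-- A weight `u` all of whose superlevel sets `{u ≥ r}`, `r ≥ 1`, are parts of minimal vertex
covers: each vertex `i` with `u i > 0` has a neighbour all of whose neighbours have weight at least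
`u i`. -/
def IsClosedWeight (A : Finset V) (u : V → ℕ) : Prop :=
  (∀ i, i ∉ A → u i = 0) ∧
    ∀ i, 0 < u i → ∃ j, G.Adj i j ∧ ∀ i', G.Adj j i' → u i ≤ u i'

/-- Every vertex of `x` has a neighbour all of whose neighbours lie in `x`. -/
def IsClosedSet (A x : Finset V) : Prop :=
  x ⊆ A ∧ ∀ i ∈ x, ∃ j, G.Adj i j ∧ ∀ i', G.Adj j i' → i' ∈ x

variable [Fintype V]

open Classical in
/-- The family of closed sets. -/
noncomputable def closedSets (A : Finset V) : Finset (Finset V) :=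
  {x | IsClosedSet G A x}

open Classical in
/-- The closed weights bounded by `k`. -/
noncomputable def closedWeights (A : Finset V) (k : ℕ) : Finset (V → ℕ) :=
  {u ∈ Fintype.piFinset fun _ => Finset.range (k + 1) | IsClosedWeight G A u}

/-- The support of a weight. -/
def weightSupport (u : V → ℕ) : Finset V := {i | 0 < u i}

variable {G} {A : Finset V}

theorem mem_closedSets {x : Finset V} : x ∈ closedSets G A ↔ IsClosedSet G A x := by
  simp [closedSets]

theorem mem_closedWeights {k : ℕ} {u : V → ℕ} :
    u ∈ closedWeights G A k ↔ (∀ i, u i ≤ k) ∧ IsClosedWeight G A u := by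
  simp [closedWeights, Fintype.mem_piFinset]

theorem mem_weightSupport {u : V → ℕ} {i : V} : i ∈ weightSupport u ↔ 0 < u i := by
  simp [weightSupport]

theorem IsClosedWeight.weightSupport_mem {u : V → ℕ} (hu : IsClosedWeight G A u) :
    weightSupport u ∈ closedSets G A := by
  rw [mem_closedSets]
  refine ⟨fun i hi => ?_, fun i hi => ?_⟩
  · by_contra h
    have := hu.1 i h
    rw [mem_weightSupport] at hi
    omega
  · rw [mem_weightSupport] at hi
    obtain ⟨j, hj, h⟩ := hu.2 i hi
    exact ⟨j, hj, fun i' hi' => mem_weightSupport.mpr (hi.trans_le (h i' hi'))⟩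

variable [DecidableEq V]

theorem card_closedWeights_eq_sum (k : ℕ) : (closedWeights G A k).card =
    ∑ x ∈ closedSets G A, ({u ∈ closedWeights G A k | weightSupport u = x} : Finset _).card :=
  Finset.card_eq_sum_card_fiberwise fun _ hu => (mem_closedWeights.mp hu).2.weightSupport_mem

/-- Subtracting `1` on the support removes the largest member `x` from the multichain of superlevel
sets; adding the indicator function of `x` puts it back. -/
theorem card_closedWeights_succ (k : ℕ) {x : Finset V} (hx : x ∈ closedSets G A) :
    ({u ∈ closedWeights G A (k + 1) | weightSupport u = x} : Finset _).card =
      ∑ y ∈ closedSets G A with y ⊆ x,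
        ({u ∈ closedWeights G A k | weightSupport u = y} : Finset _).card := by
  have hx' := mem_closedSets.mp hx
  have h1 : ({u ∈ closedWeights G A k | weightSupport u ⊆ x} : Finset _).card =
      ∑ y ∈ closedSets G A with y ⊆ x,
        ({u ∈ closedWeights G A k | weightSupport u = y} : Finset _).card := by
    rw [Finset.card_eq_sum_card_fiberwise (f := weightSupport)
      (t := ({y ∈ closedSets G A | y ⊆ x} : Finset _))]
    · refine Finset.sum_congr rfl fun y hy => ?_
      rw [Finset.filter_filter]
      congr 1
      refine Finset.filter_congr fun u _ => ⟨fun h => h.2, fun h => ⟨?_, h⟩⟩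
      rw [h]; exact (Finset.mem_filter.mp hy).2
    · intro u hu
      obtain ⟨hu, hux⟩ := Finset.mem_filter.mp hu
      exact Finset.mem_filter.mpr ⟨(mem_closedWeights.mp hu).2.weightSupport_mem, hux⟩
  rw [← h1]
  refine Finset.card_nbij' (fun u i => u i - 1) (fun u i => u i + if i ∈ x then 1 else 0)
    ?_ ?_ ?_ ?_
  · intro u hu
    obtain ⟨hu1, rfl⟩ := Finset.mem_filter.mp hu
    obtain ⟨huk, hu0, hu⟩ := mem_closedWeights.mp hu1
    refine Finset.mem_filter.mpr ⟨mem_closedWeights.mpr ⟨fun i => ?_, fun i hi => ?_,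
      fun i hi => ?_⟩, fun i hi => ?_⟩
    · have := huk i
      show u i - 1 ≤ k
      omega
    · simp [hu0 i hi]
    · dsimp only at hi
      obtain ⟨j, hj, h⟩ := hu i (by omega)
      exact ⟨j, hj, fun i' hi' => Nat.sub_le_sub_right (h i' hi') 1⟩
    · rw [mem_weightSupport] at hi ⊢
      exact hi.trans_le (Nat.sub_le _ _)
  · intro u hu
    obtain ⟨hu, hux⟩ := Finset.mem_filter.mp hu
    obtain ⟨huk, hu0, hu⟩ := mem_closedWeights.mp hu
    have hzero : ∀ i, i ∉ x → u i = 0 := fun i hi => by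
      by_contra h
      exact hi (hux (mem_weightSupport.mpr (Nat.pos_of_ne_zero h)))
    refine Finset.mem_filter.mpr ⟨mem_closedWeights.mpr ⟨fun i => ?_, fun i hi => ?_,
      fun i hi => ?_⟩, ?_⟩
    · have := huk i
      dsimp only
      split_ifs <;> omega
    · have : i ∉ x := fun h => hi (hx'.1 h)
      simp [hu0 i hi, this]
    · have hix : i ∈ x := by
        by_contra h
        simp [hzero i h, h] at hi
      -- Where `u` vanishes on `x` the new weight is `1`, with superlevel set `x` itself, so
      -- closedness of `x` supplies the neighbour.
      rcases Nat.eq_zero_or_pos (u i) with h0 | h0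
      · obtain ⟨j, hj, h⟩ := hx'.2 i hix
        exact ⟨j, hj, fun i' hi' => by simp [h0, hix, h i' hi']⟩
      · obtain ⟨j, hj, h⟩ := hu i h0
        refine ⟨j, hj, fun i' hi' => ?_⟩
        have h2 := h i' hi'
        have : i' ∈ x := hux (mem_weightSupport.mpr (by omega))
        simp [hix, this, h2]
    · ext i
      rw [mem_weightSupport]
      by_cases h : i ∈ x
      · simp [h]
      · simp [h, hzero i h]
  · intro u hu
    obtain ⟨-, rfl⟩ := Finset.mem_filter.mp hu
    funext i
    simp only [mem_weightSupport]
    split_ifs <;> omega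
  · intro u hu
    obtain ⟨hu, hux⟩ := Finset.mem_filter.mp hu
    funext i
    by_cases h : i ∈ x
    · simp [h]
    · have : ¬ 0 < u i := fun h' => h (hux (mem_weightSupport.mpr h'))
      simp only [h, if_false]
      omega

theorem card_closedWeights_one {x : Finset V} (hx : x ∈ closedSets G A) :
    ({u ∈ closedWeights G A 1 | weightSupport u = x} : Finset _).card = 1 := by
  rw [card_closedWeights_succ 0 hx]
  have h0 : ∀ u ∈ closedWeights G A 0, u = 0 := fun u hu =>
    funext fun i => Nat.le_zero.mp ((mem_closedWeights.mp hu).1 i)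
  have hs0 : weightSupport (0 : V → ℕ) = ∅ := by
    ext i; simp [mem_weightSupport]
  have hmem : (0 : V → ℕ) ∈ closedWeights G A 0 :=
    mem_closedWeights.mpr ⟨fun _ => le_rfl, fun _ _ => rfl, fun i hi => absurd hi (by simp)⟩
  rw [Finset.sum_eq_single ∅]
  · rw [Finset.card_eq_one]
    refine ⟨0, Finset.eq_singleton_iff_unique_mem.mpr ⟨Finset.mem_filter.mpr ⟨hmem, hs0⟩,
      fun u hu => h0 u (Finset.mem_filter.mp hu).1⟩⟩
  · intro y _ hy
    rw [Finset.card_eq_zero, Finset.filter_eq_empty_iff]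
    intro u hu h
    rw [h0 u hu, hs0] at h
    exact hy h.symm
  · intro h
    exact absurd (Finset.mem_filter.mpr ⟨mem_closedSets.mpr ⟨by simp, by simp⟩, by simp⟩) h

/-- The recursion starts at bound `1`, where each closed set supports exactly one weight; hence the
shift from `k + 1` to `k.choose j`. -/
theorem card_closedWeights {N : ℕ}
    (hN : ∀ x ∈ closedSets G A, chainCount (closedSets G A) (N + 1) x = 0) (k : ℕ) :
    (closedWeights G A (k + 1)).card = ∑ j ∈ Finset.range (N + 1),
      (∑ x ∈ closedSets G A, chainCount (closedSets G A) j x) * k.choose j := by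
  rw [card_closedWeights_eq_sum]
  simp_rw [Finset.sum_mul]
  rw [Finset.sum_comm]
  exact Finset.sum_congr rfl fun x hx => multichain_eq_sum_chainCount
    (fun k x => ({u ∈ closedWeights G A (k + 1) | weightSupport u = x} : Finset _).card)
    (fun x hx => card_closedWeights_one hx) (fun k x hx => card_closedWeights_succ (k + 1) hx)
    N hN k x hx

end Closed

/-! ### Basic covers of a bipartite graph -/

section Basic

variable {V : Type*}

/-- A basic `k`-cover: a `k`-cover no positive entry of which can be lowered. -/
def IsBasicCover (G : SimpleGraph V) (k : ℕ) (c : V →₀ ℕ) : Prop :=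
  IsCover G k c ∧ ∀ v, 0 < c v → ¬ IsCover G k (c - Finsupp.single v 1)

/-- Lowering an entry by `1` fails precisely when some edge at that vertex is tight. -/
theorem isBasicCover_iff {G : SimpleGraph V} {k : ℕ} {c : V →₀ ℕ} : IsBasicCover G k c ↔
    IsCover G k c ∧ ∀ v, 0 < c v → ∃ w, G.Adj v w ∧ c v + c w = k := by
  classical
  refine and_congr_right fun hc => forall₂_congr fun v hv => ⟨fun h => ?_, ?_⟩
  · by_contra! h2
    refine h fun i j hij => ?_
    have h1 := hc i j hij
    have hne := hij.ne
    simp only [Finsupp.coe_tsub, Pi.sub_apply, Finsupp.single_apply]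
    split_ifs with hi hj hj
    · exact absurd (hi.symm.trans hj) hne
    · subst hi
      have := h2 j hij
      omega
    · subst hj
      have := h2 i hij.symm
      omega
    · simpa using h1
  · rintro ⟨w, hw, h⟩ h2
    have h1 := h2 v w hw
    simp only [Finsupp.coe_tsub, Pi.sub_apply, Finsupp.single_apply, hw.ne, if_true, if_false] at h1
    omega

variable {G : SimpleGraph V} {A B : Finset V} [Fintype V]

/-- If the edge `i j` is tight, then every other neighbour `i'` of `j` satisfies `c i' ≥ k - c j = c
i`. -/
theorem IsBasicCover.isClosedWeight [DecidableEq V]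
    (hbip : G.IsBipartiteWith (A : Set V) (B : Set V)) {k : ℕ} {c : V →₀ ℕ}
    (hc : IsBasicCover G k c) :
    (fun i => if i ∈ A then c i else 0) ∈ closedWeights G A k := by
  rw [isBasicCover_iff] at hc
  obtain ⟨hcov, hc⟩ := hc
  rw [mem_closedWeights]
  refine ⟨fun i => ?_, fun i hi => by simp [hi], fun i hi => ?_⟩
  · split_ifs
    · rcases Nat.eq_zero_or_pos (c i) with h | h
      · omega
      · obtain ⟨w, -, hw⟩ := hc i h
        omega
    · omega
  · dsimp only at hi ⊢
    split_ifs at hi with hiA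
    · obtain ⟨j, hij, h⟩ := hc i hi
      refine ⟨j, hij, fun i' hi' => ?_⟩
      have hjB := hbip.mem_of_mem_adj hiA hij
      have hi'A : i' ∈ A := hbip.symm.mem_of_mem_adj hjB hi'
      have := hcov j i' hi'
      simp only [hiA, hi'A, if_true]
      omega
    · omega

/-- The basic `k`-cover with given restriction to one side of the bipartition. -/
noncomputable def coverOfWeight [DecidableEq V] (G : SimpleGraph V) [DecidableRel G.Adj]
    (A : Finset V) (k : ℕ) (u : V → ℕ) : V →₀ ℕ :=
  Finsupp.equivFunOnFinite.symm fun v =>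
    if v ∈ A then u v else (G.neighborFinset v).sup fun i => k - u i

theorem coverOfWeight_apply [DecidableEq V] [DecidableRel G.Adj] (k : ℕ) (u : V → ℕ) (v : V) :
    coverOfWeight G A k u v =
      if v ∈ A then u v else (G.neighborFinset v).sup fun i => k - u i := rfl

theorem isBasicCover_coverOfWeight [DecidableEq V] [DecidableRel G.Adj]
    (hbip : G.IsBipartiteWith (A : Set V) (B : Set V)) {k : ℕ} {u : V → ℕ}
    (hu : u ∈ closedWeights G A k) : IsBasicCover G k (coverOfWeight G A k u) := by
  obtain ⟨huk, hu0, hu⟩ := mem_closedWeights.mp hu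
  have hB : ∀ v, v ∈ B → v ∉ A := fun v hv hA =>
    Set.disjoint_left.mp hbip.disjoint hA hv
  have key : ∀ i j, i ∈ A → j ∈ B → G.Adj i j →
      k ≤ coverOfWeight G A k u i + coverOfWeight G A k u j := by
    intro i j hi hj hij
    rw [coverOfWeight_apply, coverOfWeight_apply, if_pos hi, if_neg (hB j hj)]
    have : k - u i ≤ (G.neighborFinset j).sup fun i => k - u i :=
      Finset.le_sup (f := fun i => k - u i) (by simpa using hij.symm)
    omega
  rw [isBasicCover_iff]
  constructor
  · intro i j hij
    rcases hbip.mem_of_adj hij with ⟨hi, hj⟩ | ⟨hi, hj⟩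
    · exact key i j hi hj hij
    · rw [add_comm]; exact key j i hj hi hij.symm
  · intro v hv
    by_cases hvA : v ∈ A
    · rw [coverOfWeight_apply, if_pos hvA] at hv
      obtain ⟨j, hij, h⟩ := hu v hv
      have hjB : j ∈ B := hbip.mem_of_mem_adj hvA hij
      refine ⟨j, hij, le_antisymm ?_ (key v j hvA hjB hij)⟩
      rw [coverOfWeight_apply, coverOfWeight_apply, if_pos hvA, if_neg (hB j hjB)]
      have : ((G.neighborFinset j).sup fun i => k - u i) ≤ k - u v := by
        refine Finset.sup_le fun i' hi' => ?_
        have := h i' (by simpa using hi')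
        omega
      have := huk v
      omega
    · have hv' := hv
      rw [coverOfWeight_apply, if_neg hvA] at hv
      have hne : (G.neighborFinset v).Nonempty := by
        rw [Finset.nonempty_iff_ne_empty]
        rintro h
        simp [h] at hv
      obtain ⟨i, hi, hsup⟩ := Finset.exists_mem_eq_sup _ hne fun i => k - u i
      have hvi : G.Adj v i := by simpa using hi
      refine ⟨i, hvi, ?_⟩
      have hiA : i ∈ A := by
        rcases hbip.mem_of_adj hvi with ⟨h, -⟩ | ⟨-, h⟩
        · exact absurd h hvA
        · exact h
      rw [coverOfWeight_apply, coverOfWeight_apply, if_pos hiA, if_neg hvA, hsup]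
      have := huk i
      omega

/-- The cover inequalities bound the values off `A` from below by the supremum; minimality makes a
positive value attain it, through a tight edge. -/
theorem coverOfWeight_restrict [DecidableEq V] [DecidableRel G.Adj]
    (hbip : G.IsBipartiteWith (A : Set V) (B : Set V)) {k : ℕ} {c : V →₀ ℕ}
    (hc : IsBasicCover G k c) :
    coverOfWeight G A k (fun i => if i ∈ A then c i else 0) = c := by
  obtain ⟨hcov, hc⟩ := isBasicCover_iff.mp hc
  ext v
  rw [coverOfWeight_apply]
  split_ifs with hvA
  · rfl
  · have hA : ∀ i, G.Adj v i → i ∈ A := fun i hvi => by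
      rcases hbip.mem_of_adj hvi with ⟨h, -⟩ | ⟨-, h⟩
      · exact absurd h hvA
      · exact h
    refine le_antisymm (Finset.sup_le fun i hi => ?_) ?_
    · have hvi : G.Adj v i := by simpa using hi
      rw [if_pos (hA i hvi)]
      have := hcov v i hvi
      omega
    · rcases Nat.eq_zero_or_pos (c v) with h | h
      · omega
      · obtain ⟨w, hvw, hw⟩ := hc v h
        refine le_trans ?_ (Finset.le_sup (f := fun i => k - if i ∈ A then c i else 0)
          (by simpa using hvw : w ∈ G.neighborFinset v))
        rw [if_pos (hA w hvw)]
        omega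

/-- Basic covers of a bipartite graph correspond to closed weights on one side. -/
noncomputable def basicCoverEquiv [DecidableEq V] [DecidableRel G.Adj]
    (hbip : G.IsBipartiteWith (A : Set V) (B : Set V)) (k : ℕ) :
    {c : V →₀ ℕ // IsBasicCover G k c} ≃ closedWeights G A k where
  toFun c := ⟨_, c.2.isClosedWeight hbip⟩
  invFun u := ⟨_, isBasicCover_coverOfWeight hbip u.2⟩
  left_inv c := Subtype.ext (coverOfWeight_restrict hbip c.2)
  right_inv u := by
    refine Subtype.ext (funext fun v => ?_)
    dsimp only
    split_ifs with h
    · rw [coverOfWeight_apply, if_pos h]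
    · exact ((mem_closedWeights.mp u.2).2.1 v h).symm

end Basic

end CoverAlgebra

/-! ### Krull dimension and growth of filtrations -/

theorem ringKrullDim_le_of_isIntegral (R S : Type*) [CommRing R] [CommRing S] [Algebra R S]
    [Algebra.IsIntegral R S] : ringKrullDim S ≤ ringKrullDim R :=
  Order.krullDim_le_of_strictMono (PrimeSpectrum.comap (algebraMap R S)) fun _ _ h =>
    Ideal.IsIntegral.comap_lt_comap h

/-- The Krull dimension of a finitely generated algebra is at most the order of growth of any
exhaustive filtration. -/
theorem ringKrullDim_le_of_filtration_growth {K R : Type*} [Field K] [CommRing R] [Algebra K R]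
    [Algebra.FiniteType K R] (W : ℕ → Submodule K R) (hmono : Monotone W) (hone : 1 ∈ W 0)
    (hmul : ∀ m n x y, x ∈ W m → y ∈ W n → x * y ∈ W (m + n)) (hex : ∀ x, ∃ n, x ∈ W n)
    [∀ n, Module.Finite K (W n)] (C d : ℕ)
    (hgrowth : ∀ n, Module.finrank K (W n) ≤ C * (n + 1) ^ d) :
    ringKrullDim R ≤ d := by
  classical
  cases subsingleton_or_nontrivial R with
  | inl h => rw [ringKrullDim_eq_bot_of_subsingleton]; exact bot_le
  | inr h =>
  obtain ⟨r, g, hinj, hint⟩ := exists_integral_inj_algHom_of_fg K R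
  have hdim : ringKrullDim R ≤ r := by
    algebraize [g.toRingHom]
    have : Algebra.IsIntegral (MvPolynomial (Fin r) K) R := ⟨hint⟩
    refine (ringKrullDim_le_of_isIntegral (MvPolynomial (Fin r) K) R).trans ?_
    simp
  refine hdim.trans ?_
  suffices h : r ≤ d by exact_mod_cast h
  choose N0 hN0 using hex
  obtain ⟨N, hN⟩ : ∃ N, ∀ i, g (MvPolynomial.X i) ∈ W N :=
    ⟨Finset.univ.sup fun i => N0 (g (MvPolynomial.X i)), fun i =>
      hmono (Finset.le_sup (f := fun i => N0 (g (MvPolynomial.X i))) (Finset.mem_univ i)) (hN0 _)⟩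
  have hpow : ∀ x ∈ W N, ∀ m, x ^ m ∈ W (N * m) := by
    intro x hx m
    induction m with
    | zero => simpa using hone
    | succ m ih => rw [pow_succ, mul_add, mul_one]; exact hmul _ _ _ _ ih hx
  have hprod : ∀ (c : Fin r → ℕ) (s : Finset (Fin r)),
      ∏ i ∈ s, g (MvPolynomial.X i) ^ c i ∈ W (∑ i ∈ s, N * c i) := by
    intro c s
    induction s using Finset.induction_on with
    | empty => simpa using hone
    | insert a s ha ih =>
      rw [Finset.prod_insert ha, Finset.sum_insert ha]
      exact hmul _ _ _ _ (hpow _ (hN a) _) ih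
  -- The monomials in the `r` Noether parameters with all exponents at most `n` stay independent in
  -- `R`.
  have hcard : ∀ n, (n + 1) ^ r ≤ Module.finrank K (W (N * r * n)) := by
    intro n
    let e : (Fin r → Fin (n + 1)) → (Fin r →₀ ℕ) :=
      fun c => Finsupp.equivFunOnFinite.symm fun i => (c i : ℕ)
    have he : Function.Injective e := fun c c' h => funext fun i =>
      Fin.ext (DFunLike.congr_fun h i)
    have hmem : ∀ c, g (MvPolynomial.monomial (e c) 1) ∈ W (N * r * n) := by
      intro c
      rw [MvPolynomial.monomial_eq, map_one, one_mul, Finsupp.prod_fintype _ _ (by simp), map_prod]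
      simp_rw [map_pow]
      refine hmono ?_ (hprod _ _)
      calc ∑ i, N * e c i ≤ ∑ _i : Fin r, N * n :=
            Finset.sum_le_sum fun i _ => Nat.mul_le_mul_left _ (Nat.lt_succ_iff.mp (c i).2)
        _ = N * r * n := by simp; ring
    have hli : LinearIndependent K fun c => g (MvPolynomial.monomial (e c) 1) := by
      have h1 := (MvPolynomial.basisMonomials (Fin r) K).linearIndependent.comp e he
      have h2 := h1.map' g.toLinearMap (LinearMap.ker_eq_bot.mpr hinj)
      simpa [Function.comp_def] using h2
    have hli' : LinearIndependent K
        (fun c => (⟨g (MvPolynomial.monomial (e c) 1), hmem c⟩ : W (N * r * n))) :=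
      LinearIndependent.of_comp (W (N * r * n)).subtype hli
    simpa using hli'.fintype_card_le_finrank
  by_contra! hlt
  -- For `r > d`, comparing the two bounds at `n = D` gives `(D + 1) ^ (d + 1) ≤ D * (D + 1) ^ d`,
  -- which is absurd.
  set D := C * (N * r + 1) ^ d with hD
  have h1 : (D + 1) ^ (d + 1) ≤ D * (D + 1) ^ d := calc
    (D + 1) ^ (d + 1) ≤ (D + 1) ^ r := Nat.pow_le_pow_right (by omega) hlt
    _ ≤ C * (N * r * D + 1) ^ d := (hcard D).trans (hgrowth _)
    _ ≤ C * ((N * r + 1) * (D + 1)) ^ d :=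
      Nat.mul_le_mul_left _ (Nat.pow_le_pow_left (by nlinarith [Nat.zero_le (N * r)]) d)
    _ = D * (D + 1) ^ d := by rw [mul_pow, hD]; ring
  rw [pow_succ'] at h1
  have := Nat.le_of_mul_le_mul_right h1 (by positivity)
  omega

theorem Submodule.finite_biSup_and_finrank_le {K R ι : Type*} [Field K] [CommRing R]
    [Algebra K R] (W : ι → Submodule K R) (s : Finset ι) (hW : ∀ i, Module.Finite K (W i)) :
    Module.Finite K ↥(⨆ i ∈ s, W i) ∧
      Module.finrank K ↥(⨆ i ∈ s, W i) ≤ ∑ i ∈ s, Module.finrank K (W i) := by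
  classical
  induction s using Finset.induction_on with
  | empty =>
    have h : (⨆ i ∈ (∅ : Finset ι), W i) = ⊥ := by simp
    rw [h]
    exact ⟨inferInstance, by simp⟩
  | insert a s ha ih =>
    obtain ⟨ih1, ih2⟩ := ih
    rw [Finset.iSup_insert, Finset.sum_insert ha]
    exact ⟨Submodule.finite_sup _ _, (Submodule.finrank_add_le_finrank_add_finrank _ _).trans
      (Nat.add_le_add_left ih2 _)⟩

namespace CoverAlgebra

/-! ### The monomial basis of `Ā(G)` and its degree filtration -/

section Algebra

variable {V K : Type*} [Field K] {G : SimpleGraph V}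

/-- The monomial `x ^ c * t ^ k` of a `k`-cover. -/
noncomputable def coverMonomial (K : Type*) [Field K] {k : ℕ} {c : V →₀ ℕ} (hc : IsCover G k c) :
    vertexCoverAlgebra K G :=
  ⟨Polynomial.monomial k (MvPolynomial.monomial c 1), by
    classical
    intro l b hb
    rw [Polynomial.coeff_monomial] at hb
    split_ifs at hb with h
    · subst h
      rw [Finset.mem_singleton.mp (MvPolynomial.support_monomial_subset hb)]
      exact hc
    · simp at hb⟩

theorem coe_coverMonomial {k : ℕ} {c : V →₀ ℕ} (hc : IsCover G k c) :
    (coverMonomial K hc : (MvPolynomial V K)[X]) =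
      Polynomial.monomial k (MvPolynomial.monomial c 1) := rfl

theorem coverMonomial_mem_coverPiece {k : ℕ} {c : V →₀ ℕ} (hc : IsCover G k c) :
    coverMonomial K hc ∈ coverPiece K G k := fun j hj => by
  rw [coe_coverMonomial, Polynomial.coeff_monomial, if_neg hj.symm]

theorem coverMonomial_mul {k l : ℕ} {b c : V →₀ ℕ} (hb : IsCover G k b) (hc : IsCover G l c) :
    coverMonomial K hb * coverMonomial K hc = coverMonomial K (hb.add hc) := by
  refine Subtype.ext ?_
  rw [MulMemClass.coe_mul, coe_coverMonomial, coe_coverMonomial, coe_coverMonomial,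
    Polynomial.monomial_mul_monomial, MvPolynomial.monomial_mul, one_mul]

theorem coverMonomial_congr {k l : ℕ} {b c : V →₀ ℕ} (hb : IsCover G k b) (hc : IsCover G l c)
    (hkl : k = l) (hbc : b = c) : coverMonomial K hb = coverMonomial K hc := by
  subst hkl hbc; rfl

theorem coverMonomial_single (v : V) :
    coverMonomial K (isCover_zero G (Finsupp.single v 1)) =
      algebraMap (MvPolynomial V K) (vertexCoverAlgebra K G) (MvPolynomial.X v) :=
  Subtype.ext rfl

/-- The component of degree `k` of an element of the vertex cover algebra. -/
noncomputable def coverComponent (k : ℕ) (f : vertexCoverAlgebra K G) : vertexCoverAlgebra K G :=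
  ⟨Polynomial.monomial k ((f : (MvPolynomial V K)[X]).coeff k), by
    intro l b hb
    rw [Polynomial.coeff_monomial] at hb
    split_ifs at hb with h
    · subst h
      exact f.2 _ _ hb
    · simp at hb⟩

theorem coe_coverComponent (k : ℕ) (f : vertexCoverAlgebra K G) :
    (coverComponent k f : (MvPolynomial V K)[X]) =
      Polynomial.monomial k ((f : (MvPolynomial V K)[X]).coeff k) := rfl

theorem coverComponent_mem (k : ℕ) (f : vertexCoverAlgebra K G) :
    coverComponent k f ∈ coverPiece K G k := fun j hj => by
  rw [coe_coverComponent, Polynomial.coeff_monomial, if_neg hj.symm]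

theorem sum_coverComponent {n : ℕ} (f : vertexCoverAlgebra K G)
    (hn : (f : (MvPolynomial V K)[X]).natDegree < n) :
    ∑ k ∈ Finset.range n, coverComponent k f = f := by
  refine Subtype.ext ?_
  rw [AddSubmonoidClass.coe_finsetSum]
  simp_rw [coe_coverComponent]
  exact (Polynomial.as_sum_range' _ _ hn).symm

theorem mem_span_coverMonomial {k : ℕ} {f : vertexCoverAlgebra K G} (hf : f ∈ coverPiece K G k) :
    f ∈ Submodule.span K
      (Set.range fun c : {c : V →₀ ℕ // IsCover G k c} => coverMonomial K c.2) := by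
  classical
  set p := (f : (MvPolynomial V K)[X]).coeff k with hp
  have h : f = ∑ c : p.support, (p.coeff c) • coverMonomial K (f.2 k c c.2) := by
    refine Subtype.ext ?_
    rw [AddSubmonoidClass.coe_finsetSum]
    have h1 : ∀ c : p.support,
        ((p.coeff c • coverMonomial K (f.2 k c c.2) : vertexCoverAlgebra K G) :
          (MvPolynomial V K)[X]) = Polynomial.monomial k (MvPolynomial.monomial c (p.coeff c)) := by
      intro c
      change p.coeff c • Polynomial.monomial k (MvPolynomial.monomial (c : V →₀ ℕ) (1 : K)) = _
      rw [Polynomial.smul_monomial, MvPolynomial.smul_monomial, smul_eq_mul, mul_one]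
    simp_rw [h1]
    rw [Finset.sum_coe_sort p.support
      (fun c => Polynomial.monomial k (MvPolynomial.monomial c (p.coeff c))), ← map_sum,
      ← MvPolynomial.as_sum p]
    ext1 j
    rw [Polynomial.coeff_monomial]
    split_ifs with hj
    · rw [← hj]
    · exact hf j (Ne.symm hj)
  rw [h]
  exact Submodule.sum_mem _ fun c _ => Submodule.smul_mem _ _
    (Submodule.subset_span ⟨⟨c, f.2 k c c.2⟩, rfl⟩)

variable (K G) in
/-- The projection `A(G) → Ā(G)`. -/
noncomputable def toBasic : vertexCoverAlgebra K G →ₐ[K] BasicCoverAlgebra K G :=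
  Ideal.Quotient.mkₐ K
    ((irrelevantIdeal V K).map (algebraMap (MvPolynomial V K) (vertexCoverAlgebra K G)))

theorem toBasic_surjective : Function.Surjective (toBasic K G) :=
  Ideal.Quotient.mkₐ_surjective _ _

theorem toBasic_eq_zero_iff {f : vertexCoverAlgebra K G} : toBasic K G f = 0 ↔
    f ∈ (irrelevantIdeal V K).map (algebraMap (MvPolynomial V K) (vertexCoverAlgebra K G)) :=
  Ideal.Quotient.eq_zero_iff_mem

theorem basicCoverPiece_eq (k : ℕ) :
    basicCoverPiece K G k = (coverPiece K G k).map (toBasic K G).toLinearMap := rfl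

variable (K G) in
/-- The coefficient of `x ^ c * t ^ k`. -/
noncomputable def coverCoeff (k : ℕ) (c : V →₀ ℕ) : vertexCoverAlgebra K G →ₗ[K] K where
  toFun f := ((f : (MvPolynomial V K)[X]).coeff k).coeff c
  map_add' f g := by simp
  map_smul' a f := by
    change ((a • (f : (MvPolynomial V K)[X])).coeff k).coeff c = _
    rw [Polynomial.coeff_smul, MvPolynomial.coeff_smul]
    rfl

theorem coverCoeff_apply (k : ℕ) (c : V →₀ ℕ) (f : vertexCoverAlgebra K G) :
    coverCoeff K G k c f = ((f : (MvPolynomial V K)[X]).coeff k).coeff c := rfl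

theorem coverCoeff_coverMonomial [DecidableEq V] {k : ℕ} {b c : V →₀ ℕ} (hb : IsCover G k b) :
    coverCoeff K G k c (coverMonomial K hb) = if b = c then 1 else 0 := by
  rw [coverCoeff_apply, coe_coverMonomial, Polynomial.coeff_monomial, if_pos rfl,
    MvPolynomial.coeff_monomial]

theorem coverCoeff_eq_zero {k : ℕ} {c : V →₀ ℕ} (hc : IsBasicCover G k c)
    {f : vertexCoverAlgebra K G} (hf : toBasic K G f = 0) : coverCoeff K G k c f = 0 := by
  classical
  rw [toBasic_eq_zero_iff, irrelevantIdeal, Ideal.map_span] at hf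
  -- Quantifying over multipliers makes the claim stable under the ideal operations. On a generator
  -- `X v`, a nonzero coefficient would make `c - Finsupp.single v 1` a `k`-cover, against
  -- minimality.
  suffices h : ∀ g, coverCoeff K G k c (g * f) = 0 by simpa using h 1
  refine Submodule.span_induction (p := fun f _ => ∀ g, coverCoeff K G k c (g * f) = 0)
    ?_ ?_ ?_ ?_ hf
  · rintro _ ⟨_, ⟨v, rfl⟩, rfl⟩ g
    have h : ((g * algebraMap (MvPolynomial V K) (vertexCoverAlgebra K G) (MvPolynomial.X v) :
        vertexCoverAlgebra K G) : (MvPolynomial V K)[X]) =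
        (g : (MvPolynomial V K)[X]) * Polynomial.C (MvPolynomial.X v) := rfl
    rw [coverCoeff_apply, h, Polynomial.coeff_mul_C, MvPolynomial.coeff_mul_X']
    split_ifs with hv
    · by_contra hne
      refine hc.2 v (Nat.pos_of_ne_zero (Finsupp.mem_support_iff.mp hv)) (g.2 k _ ?_)
      exact MvPolynomial.mem_support_iff.mpr hne
    · rfl
  · intro g; simp
  · intro x y _ _ hx hy g
    rw [mul_add, map_add, hx, hy, add_zero]
  · intro a x _ hx g
    rw [smul_eq_mul, ← mul_assoc]
    exact hx _

theorem toBasic_coverMonomial_eq_zero {k : ℕ} {c : V →₀ ℕ} (hc : IsCover G k c)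
    (hnb : ¬ IsBasicCover G k c) : toBasic K G (coverMonomial K hc) = 0 := by
  simp only [IsBasicCover, hc, true_and, not_forall, not_not] at hnb
  obtain ⟨v, hv, hcv⟩ := hnb
  have h : coverMonomial K hc = coverMonomial K hcv *
      coverMonomial K (isCover_zero G (Finsupp.single v 1)) := by
    rw [coverMonomial_mul]
    exact coverMonomial_congr _ _ rfl
      (tsub_add_cancel_of_le (Finsupp.single_le_iff.mpr hv)).symm
  rw [toBasic_eq_zero_iff, h, coverMonomial_single]
  exact Ideal.mul_mem_left _ _ (Ideal.mem_map_of_mem _ (Ideal.subset_span ⟨v, rfl⟩))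

theorem span_toBasic_coverMonomial (k : ℕ) :
    Submodule.span K (Set.range fun c : {c : V →₀ ℕ // IsBasicCover G k c} =>
      toBasic K G (coverMonomial K c.2.1)) = basicCoverPiece K G k := by
  rw [basicCoverPiece_eq]
  refine le_antisymm (Submodule.span_le.mpr ?_) ?_
  · rintro _ ⟨c, rfl⟩
    exact Submodule.mem_map_of_mem (f := (toBasic K G).toLinearMap)
      (coverMonomial_mem_coverPiece c.2.1)
  · rw [Submodule.map_le_iff_le_comap]
    intro f hf
    refine Submodule.span_le.mpr ?_ (mem_span_coverMonomial hf)
    rintro _ ⟨c, rfl⟩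
    change toBasic K G (coverMonomial K c.2) ∈ Submodule.span K _
    by_cases hc : IsBasicCover G k c
    · exact Submodule.subset_span ⟨⟨c, hc⟩, rfl⟩
    · rw [toBasic_coverMonomial_eq_zero c.2 hc]
      exact Submodule.zero_mem _

theorem linearIndependent_toBasic_coverMonomial (k : ℕ) :
    LinearIndependent K fun c : {c : V →₀ ℕ // IsBasicCover G k c} =>
      toBasic K G (coverMonomial K c.2.1) := by
  classical
  rw [linearIndependent_iff']
  intro s a ha c hcs
  have h1 : toBasic K G (∑ b ∈ s, a b • coverMonomial K b.2.1) = 0 := by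
    rw [← ha, map_sum]
    exact Finset.sum_congr rfl fun b _ => (toBasic K G).toLinearMap.map_smul _ _
  have h2 := coverCoeff_eq_zero c.2 h1
  rw [map_sum, Finset.sum_eq_single c] at h2
  · rwa [map_smul, coverCoeff_coverMonomial, if_pos rfl, smul_eq_mul, mul_one] at h2
  · intro b _ hb
    rw [map_smul, coverCoeff_coverMonomial, if_neg fun h => hb (Subtype.ext h), smul_zero]
  · exact fun h => absurd hcs h

theorem finrank_eq_card_of_span_eq {W : Submodule K (BasicCoverAlgebra K G)} {ι : Type*}
    [Fintype ι] {b : ι → BasicCoverAlgebra K G} (hW : Submodule.span K (Set.range b) = W)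
    (hb : LinearIndependent K b) : Module.finrank K W = Fintype.card ι := by
  rw [← hW, finrank_span_eq_card hb]

theorem finrank_basicCoverPiece (k : ℕ) [Fintype {c : V →₀ ℕ // IsBasicCover G k c}] :
    Module.finrank K (basicCoverPiece K G k) =
      Fintype.card {c : V →₀ ℕ // IsBasicCover G k c} := by
  have h1 := linearIndependent_toBasic_coverMonomial (K := K) (G := G) k
  have h2 := span_toBasic_coverMonomial (K := K) (G := G) k
  exact finrank_eq_card_of_span_eq h2 h1

theorem hilbertFunction_eq_card (k : ℕ) [Fintype {c : V →₀ ℕ // IsBasicCover G k c}] :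
    hilbertFunction K G k = Fintype.card {c : V →₀ ℕ // IsBasicCover G k c} :=
  finrank_basicCoverPiece k

theorem finite_basicCoverPiece (k : ℕ) [Finite {c : V →₀ ℕ // IsBasicCover G k c}] :
    Module.Finite K (basicCoverPiece K G k) := by
  rw [← span_toBasic_coverMonomial]
  exact Module.Finite.span_of_finite K (Set.finite_range _)

/-- The filtration of `Ā(G)` by degree in `t`. -/
noncomputable def basicFiltration (K : Type*) [Field K] (G : SimpleGraph V) (n : ℕ) :
    Submodule K (BasicCoverAlgebra K G) :=
  ⨆ k ∈ Finset.range (n + 1), basicCoverPiece K G k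

theorem toBasic_mem_basicFiltration {n : ℕ} {f : vertexCoverAlgebra K G}
    (hn : (f : (MvPolynomial V K)[X]).natDegree ≤ n) :
    toBasic K G f ∈ basicFiltration K G n := by
  rw [← sum_coverComponent f (Nat.lt_succ_of_le hn), map_sum]
  refine Submodule.sum_mem _ fun k hk => ?_
  exact (le_iSup₂_of_le (f := fun k _ => basicCoverPiece K G k) k hk le_rfl)
    (Submodule.mem_map_of_mem (f := (toBasic K G).toLinearMap) (coverComponent_mem k f))

/-- Lifting to representatives of bounded degree in `t` reduces multiplicativity of the filtration
to the degree bound for products of polynomials. -/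
theorem exists_natDegree_le_of_mem_basicFiltration {n : ℕ} {x : BasicCoverAlgebra K G}
    (hx : x ∈ basicFiltration K G n) : ∃ f : vertexCoverAlgebra K G,
      (f : (MvPolynomial V K)[X]).natDegree ≤ n ∧ toBasic K G f = x := by
  let D : Submodule K (vertexCoverAlgebra K G) :=
    { carrier := {f | (f : (MvPolynomial V K)[X]).natDegree ≤ n}
      zero_mem' := by simp
      add_mem' := fun {f g} hf hg => (Polynomial.natDegree_add_le _ _).trans (max_le hf hg)
      smul_mem' := fun a f hf => (Polynomial.natDegree_smul_le a _).trans hf }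
  have h : basicFiltration K G n ≤ D.map (toBasic K G).toLinearMap := by
    refine iSup₂_le fun k hk => Submodule.map_mono fun f hf => ?_
    refine Polynomial.natDegree_le_iff_coeff_eq_zero.mpr fun j hj => hf j ?_
    have := Finset.mem_range.mp hk
    omega
  obtain ⟨f, hf, rfl⟩ := h hx
  exact ⟨f, hf, rfl⟩

theorem finite_basicFiltration (n : ℕ)
    [∀ k, Finite {c : V →₀ ℕ // IsBasicCover G k c}] :
    Module.Finite K (basicFiltration K G n) :=
  (Submodule.finite_biSup_and_finrank_le (basicCoverPiece K G) (Finset.range (n + 1))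
    fun k => finite_basicCoverPiece k).1

theorem finrank_basicFiltration_le (n : ℕ) [∀ k, Finite {c : V →₀ ℕ // IsBasicCover G k c}] :
    Module.finrank K (basicFiltration K G n) ≤
      ∑ k ∈ Finset.range (n + 1), hilbertFunction K G k :=
  (Submodule.finite_biSup_and_finrank_le (basicCoverPiece K G) (Finset.range (n + 1))
    fun k => finite_basicCoverPiece k).2

theorem ringKrullDim_basicCoverAlgebra_le [Algebra.FiniteType K (vertexCoverAlgebra K G)]
    [∀ k, Finite {c : V →₀ ℕ // IsBasicCover G k c}] (C d : ℕ)
    (hH : ∀ k, hilbertFunction K G k ≤ C * (k + 1) ^ d) :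
    ringKrullDim (BasicCoverAlgebra K G) ≤ (d + 1 : ℕ) := by
  have hft : Algebra.FiniteType K (BasicCoverAlgebra K G) :=
    Algebra.FiniteType.of_surjective (toBasic K G) toBasic_surjective
  have hfin := fun n => finite_basicFiltration (K := K) (G := G) n
  refine ringKrullDim_le_of_filtration_growth (K := K) (basicFiltration K G) ?_ ?_ ?_ ?_ C (d + 1)
    fun n => ?_
  · intro m n hmn
    exact biSup_mono fun k hk => by
      have := Finset.mem_range.mp hk
      exact Finset.mem_range.mpr (by omega)
  · rw [← map_one (toBasic K G)]
    exact toBasic_mem_basicFiltration (by simp)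
  · intro m n x y hx hy
    obtain ⟨f, hf, rfl⟩ := exists_natDegree_le_of_mem_basicFiltration hx
    obtain ⟨g, hg, rfl⟩ := exists_natDegree_le_of_mem_basicFiltration hy
    rw [← map_mul]
    exact toBasic_mem_basicFiltration (Polynomial.natDegree_mul_le_of_le hf hg)
  · intro x
    obtain ⟨f, rfl⟩ := toBasic_surjective x
    exact ⟨_, toBasic_mem_basicFiltration le_rfl⟩
  · calc Module.finrank K (basicFiltration K G n)
        ≤ ∑ k ∈ Finset.range (n + 1), hilbertFunction K G k := finrank_basicFiltration_le n
      _ ≤ ∑ k ∈ Finset.range (n + 1), C * (n + 1) ^ d :=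
        Finset.sum_le_sum fun k hk => (hH k).trans (Nat.mul_le_mul_left _
          (Nat.pow_le_pow_left (Finset.mem_range.mp hk) d))
      _ = C * (n + 1) ^ (d + 1) := by
        rw [Finset.sum_const, Finset.card_range, smul_eq_mul, pow_succ]; ring

end Algebra

/-! ### Finite generation, dimension and Hilbert polynomial -/

section Finiteness

variable {V K : Type*} [Field K] [Fintype V] {G : SimpleGraph V} {A B : Finset V}

/-- In a bipartite graph every `(k + 1)`-cover is the sum of a squarefree `1`-cover and a
`k`-cover. -/
theorem IsCover.exists_add (hbip : G.IsBipartiteWith (A : Set V) (B : Set V))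
    {k : ℕ} {c : V →₀ ℕ} (hc : IsCover G (k + 1) c) :
    ∃ b d : V →₀ ℕ, IsCover G 1 b ∧ (∀ v, b v ≤ 1) ∧ IsCover G k d ∧ b + d = c := by
  classical
  -- The thresholds `1` on `A` and `k + 1` off `A` are complementary: on an edge at least one is
  -- reached, and if both are, then `c i + c j ≥ k + 2`, so both ends can be lowered.
  let b : V →₀ ℕ := Finsupp.equivFunOnFinite.symm fun v =>
    if v ∈ A then (if 1 ≤ c v then 1 else 0) else if k + 1 ≤ c v then 1 else 0
  have hb : ∀ v, b v = if v ∈ A then (if 1 ≤ c v then 1 else 0) else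
    if k + 1 ≤ c v then 1 else 0 := fun v => rfl
  have hB : ∀ v, v ∈ B → v ∉ A := fun v hv hA => Set.disjoint_left.mp hbip.disjoint hA hv
  have hsymm : ∀ (l : ℕ) (f : V →₀ ℕ),
      (∀ i j, i ∈ A → j ∈ B → G.Adj i j → l ≤ f i + f j) → IsCover G l f := by
    intro l f h i j hij
    rcases hbip.mem_of_adj hij with ⟨hi, hj⟩ | ⟨hi, hj⟩
    · exact h i j hi hj hij
    · rw [add_comm]; exact h j i hj hi hij.symm
  refine ⟨b, c - b, hsymm _ _ fun i j hi hj hij => ?_, fun v => ?_,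
    hsymm _ _ fun i j hi hj hij => ?_, add_tsub_cancel_of_le fun v => ?_⟩
  · have := hc i j hij
    rw [hb, hb, if_pos hi, if_neg (hB j hj)]
    split_ifs <;> omega
  · rw [hb]; split_ifs <;> omega
  · have := hc i j hij
    rw [Finsupp.tsub_apply, Finsupp.tsub_apply, hb, hb, if_pos hi, if_neg (hB j hj)]
    split_ifs <;> omega
  · rw [hb]; split_ifs <;> omega

/-- Repeated splitting shows that the variables and the finitely many squarefree `1`-covers
generate. -/
theorem finiteType_vertexCoverAlgebra (hbip : G.IsBipartiteWith (A : Set V) (B : Set V)) :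
    Algebra.FiniteType K (vertexCoverAlgebra K G) := by
  classical
  let d : V →₀ ℕ := Finsupp.equivFunOnFinite.symm fun _ => 1
  let T : Set (vertexCoverAlgebra K G) :=
    Set.range (fun v => coverMonomial K (isCover_zero G (Finsupp.single v 1))) ∪
      Set.range fun c : {c : V →₀ ℕ // c ≤ d ∧ IsCover G 1 c} => coverMonomial K c.2.2
  have hfin : Finite {c : V →₀ ℕ // c ≤ d ∧ IsCover G 1 c} :=
    ((Set.finite_Iic d).subset fun c hc => hc.1 : {c | c ≤ d ∧ IsCover G 1 c}.Finite)
  have h0 : ∀ c : V →₀ ℕ, coverMonomial K (isCover_zero G c) ∈ Algebra.adjoin K T := by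
    intro c
    induction c using Finsupp.induction_linear with
    | zero => exact Subalgebra.one_mem _
    | add f g hf hg =>
      have := Subalgebra.mul_mem _ hf hg
      rwa [coverMonomial_mul] at this
    | single v n =>
      induction n with
      | zero =>
        rw [coverMonomial_congr _ (isCover_zero G 0) rfl (Finsupp.single_zero v)]
        exact Subalgebra.one_mem _
      | succ n ih =>
        have hvT : coverMonomial K (isCover_zero G (Finsupp.single v 1)) ∈ T := Or.inl ⟨v, rfl⟩
        have := Subalgebra.mul_mem (Algebra.adjoin K T) ih (Algebra.subset_adjoin hvT)
        rw [coverMonomial_mul] at this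
        rwa [coverMonomial_congr _ (isCover_zero G _) rfl (Finsupp.single_add v n 1)]
  have hmon : ∀ (k : ℕ) (c : V →₀ ℕ) (hc : IsCover G k c),
      coverMonomial K hc ∈ Algebra.adjoin K T := by
    intro k
    induction k with
    | zero => exact fun c _ => h0 c
    | succ k ih =>
      intro c hc
      obtain ⟨b, e, hb, hb1, he, rfl⟩ := hc.exists_add hbip
      have hbT : coverMonomial K hb ∈ T := Or.inr ⟨⟨b, hb1, hb⟩, rfl⟩
      have := Subalgebra.mul_mem (Algebra.adjoin K T) (Algebra.subset_adjoin hbT) (ih e he)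
      rw [coverMonomial_mul] at this
      rwa [coverMonomial_congr hc (hb.add he) (add_comm k 1) rfl]
  refine ⟨Subalgebra.fg_def.mpr ⟨T, (Set.finite_range _).union (Set.finite_range _), ?_⟩⟩
  refine eq_top_iff.mpr fun f _ => ?_
  rw [← sum_coverComponent f (Nat.lt_succ_self _)]
  refine Subalgebra.sum_mem _ fun k _ => ?_
  have h1 : Submodule.span K
      (Set.range fun c : {c : V →₀ ℕ // IsCover G k c} => coverMonomial K c.2) ≤
      Subalgebra.toSubmodule (Algebra.adjoin K T) := by
    rw [Submodule.span_le]
    rintro _ ⟨c, rfl⟩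
    exact hmon k c c.2
  exact h1 (mem_span_coverMonomial (coverComponent_mem k f))

variable [DecidableEq V] [DecidableRel G.Adj]

theorem hilbertFunction_eq_card_closedWeights
    (hbip : G.IsBipartiteWith (A : Set V) (B : Set V)) (k : ℕ) :
    hilbertFunction K G k = (closedWeights G A k).card := by
  have := Fintype.ofEquiv _ (basicCoverEquiv hbip k).symm
  rw [hilbertFunction_eq_card, Fintype.card_congr (basicCoverEquiv hbip k), Fintype.card_coe]

theorem ringKrullDim_basicCoverAlgebra_le_of_chainCount
    (hbip : G.IsBipartiteWith (A : Set V) (B : Set V)) {N : ℕ}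
    (hN : ∀ x ∈ closedSets G A, chainCount (closedSets G A) (N + 1) x = 0) (d : ℕ)
    (hd : ∀ j ≤ N, d < j → ∑ x ∈ closedSets G A, chainCount (closedSets G A) j x = 0) :
    ringKrullDim (BasicCoverAlgebra K G) ≤ (d + 1 : ℕ) := by
  have hft := finiteType_vertexCoverAlgebra (K := K) hbip
  have hfin := fun k => Finite.of_equiv _ (basicCoverEquiv hbip k).symm
  set β : ℕ → ℕ := fun j => ∑ x ∈ closedSets G A, chainCount (closedSets G A) j x with hβ
  -- The summand for bound `0` takes care of degree `0`, which the binomial formula does not reach.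
  refine ringKrullDim_basicCoverAlgebra_le
    ((closedWeights G A 0).card + ∑ j ∈ Finset.range (N + 1), β j) d fun k => ?_
  rw [hilbertFunction_eq_card_closedWeights hbip]
  cases k with
  | zero => simp
  | succ k =>
    rw [card_closedWeights hN, add_mul]
    refine le_add_left ?_
    rw [Finset.sum_mul]
    refine Finset.sum_le_sum fun j hj => ?_
    rcases le_or_gt j d with h | h
    · exact Nat.mul_le_mul_left _ <| (Nat.choose_le_pow k j).trans <|
        (Nat.pow_le_pow_left (by omega) j).trans (Nat.pow_le_pow_right (by omega) h)
    · rw [hd j (Nat.lt_succ_iff.mp (Finset.mem_range.mp hj)) h, zero_mul]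
      exact Nat.zero_le _

theorem isMultiplicity_hilbertFunction
    (hbip : G.IsBipartiteWith (A : Set V) (B : Set V)) {N : ℕ}
    (hN : ∀ x ∈ closedSets G A, chainCount (closedSets G A) (N + 1) x = 0)
    (hpos : ∑ x ∈ closedSets G A, chainCount (closedSets G A) N x ≠ 0) :
    IsMultiplicity (hilbertFunction K G)
      ((∑ x ∈ closedSets G A, chainCount (closedSets G A) N x : ℕ) : ℚ) := by
  set β : ℕ → ℕ := fun j => ∑ x ∈ closedSets G A, chainCount (closedSets G A) j x with hβ
  -- `preHilbertPoly ℚ j (j + 1)` takes the value `k.choose j` at `k + 1` for `k ≥ j`, and its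
  -- leading coefficient is `1 / j!`.
  set Q : ℚ[X] := ∑ j ∈ Finset.range (N + 1),
    (β j : ℚ) • Polynomial.preHilbertPoly ℚ j (j + 1) with hQ
  have hle : Q.natDegree ≤ N := Polynomial.natDegree_sum_le_of_forall_le _ _ fun j hj => by
    refine (Polynomial.natDegree_smul_le _ _).trans ?_
    rw [Polynomial.natDegree_preHilbertPoly]
    exact Nat.lt_succ_iff.mp (Finset.mem_range.mp hj)
  have hcoeff : Q.coeff N = β N * (N.factorial : ℚ)⁻¹ := by
    rw [hQ, Polynomial.finsetSum_coeff, Finset.sum_range_succ, Finset.sum_eq_zero, zero_add,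
      Polynomial.coeff_smul, Polynomial.coeff_preHilbertPoly_self, smul_eq_mul]
    intro j hj
    rw [Polynomial.coeff_smul, Polynomial.coeff_eq_zero_of_natDegree_lt, smul_zero]
    rw [Polynomial.natDegree_preHilbertPoly]
    exact Finset.mem_range.mp hj
  have hNfac : (N.factorial : ℚ) ≠ 0 := by positivity
  have hne : Q.coeff N ≠ 0 := by
    rw [hcoeff]
    exact mul_ne_zero (Nat.cast_ne_zero.mpr hpos) (inv_ne_zero hNfac)
  have hdeg : Q.natDegree = N := le_antisymm hle (Polynomial.le_natDegree_of_ne_zero hne)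
  refine ⟨Q, ?_, ?_⟩
  · filter_upwards [eventually_ge_atTop (N + 1)] with k hk
    obtain ⟨k, rfl⟩ : ∃ l, k = l + 1 := ⟨k - 1, by omega⟩
    rw [hilbertFunction_eq_card_closedWeights hbip, card_closedWeights hN, hQ,
      Polynomial.eval_finsetSum, Nat.cast_sum]
    refine Finset.sum_congr rfl fun j hj => ?_
    have hj' := Finset.mem_range.mp hj
    rw [Polynomial.eval_smul, Polynomial.preHilbertPoly_eq_choose_sub_add ℚ j (by omega),
      smul_eq_mul, Nat.cast_mul, show k + 1 - (j + 1) + j = k by omega]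
  · rw [Polynomial.leadingCoeff, hdeg, hcoeff, mul_assoc, inv_mul_cancel₀ hNfac, mul_one]

end Finiteness

end CoverAlgebra

/-- `G` is a finite graph with at least one edge, bipartite with respect to a partition `A`, `B` of
its vertices, and every vertex of `B` has degree at least `s`. As `B` is then nonempty, `s` is at
most the cardinality of `A`, so that the subtractions below do not truncate. -/
theorem mainTheorem7 {K : Type*} [Field K] {V : Type*} [Fintype V] [DecidableEq V]
    (G : SimpleGraph V) [DecidableRel G.Adj] (A B : Finset V)
    (hpart : A ∪ B = Finset.univ) (hbip : G.IsBipartiteWith (A : Set V) (B : Set V))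
    (hedge : ∃ i j : V, G.Adj i j)
    (s : ℕ) (hdeg : ∀ j ∈ B, s ≤ G.degree j) :
    ringKrullDim (CoverAlgebra.BasicCoverAlgebra K G) ≤ ((A.card - s + 2 : ℕ) : WithBot ℕ∞) ∧
    (ringKrullDim (CoverAlgebra.BasicCoverAlgebra K G) = ((A.card - s + 2 : ℕ) : WithBot ℕ∞) →
      ∃ e : ℚ, CoverAlgebra.IsMultiplicity (CoverAlgebra.hilbertFunction K G) e ∧
        e ≤ ((A.card.choose s * (A.card - s).factorial : ℕ) : ℚ)) := by
  have hclosed : ∀ x ∈ CoverAlgebra.closedSets G A, x.Nonempty → s ≤ x.card := by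
    rintro x hx ⟨i, hi⟩
    obtain ⟨hxA, hx⟩ := CoverAlgebra.mem_closedSets.mp hx
    obtain ⟨j, hij, hj⟩ := hx i hi
    have hjB : j ∈ B := hbip.mem_of_mem_adj (hxA hi) hij
    exact (hdeg j hjB).trans (Finset.card_le_card fun i' hi' => hj i' (by simpa using hi'))
  have hsA : s ≤ A.card := by
    obtain ⟨i, j, hij⟩ := hedge
    obtain ⟨i, j, hij, hi, hj⟩ : ∃ i j, G.Adj i j ∧ i ∈ A ∧ j ∈ B := by
      rcases hbip.mem_of_adj hij with ⟨hi, hj⟩ | ⟨hi, hj⟩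
      · exact ⟨i, j, hij, hi, hj⟩
      · exact ⟨j, i, hij.symm, hj, hi⟩
    exact (hdeg j hj).trans (Finset.card_le_card fun i' hi' =>
      hbip.symm.mem_of_mem_adj hj (by simpa using hi'))
  have hN : ∀ x ∈ CoverAlgebra.closedSets G A,
      CoverAlgebra.chainCount (CoverAlgebra.closedSets G A) (A.card - s + 1 + 1) x = 0 :=
    fun x hx => CoverAlgebra.chainCount_eq_zero hclosed _ x hx (by
      have := Finset.card_le_card (CoverAlgebra.mem_closedSets.mp hx).1
      omega)
  refine ⟨CoverAlgebra.ringKrullDim_basicCoverAlgebra_le_of_chainCount hbip hN _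
    fun j hj hlt => absurd hj (by omega), fun hdim => ⟨_,
      CoverAlgebra.isMultiplicity_hilbertFunction hbip hN fun hzero => ?_,
      Nat.cast_le.mpr (CoverAlgebra.sum_chainCount_le hsA
        (fun x hx => (CoverAlgebra.mem_closedSets.mp hx).1) hclosed)⟩⟩
  -- Without chains of maximal size the growth order drops by one, and the dimension would be at
  -- most `A.card - s + 1`.
  have h := CoverAlgebra.ringKrullDim_basicCoverAlgebra_le_of_chainCount (K := K) hbip hN
    (A.card - s) fun j hj hlt => by
      obtain rfl : j = A.card - s + 1 := by omega
      exact hzero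
  rw [hdim, Nat.cast_le] at h
  omega
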